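/- Let $X$ be a Tychonoff space. Let $C_p(X)$ and $C_p(X,[0,1])$ be the sets of continuous functions from $X$ to $\mathbb{R}$ and to $[0,1]$, and let $B_1(X)$ be the set of Baire-one functions on $X$ (pointwise limits of sequences of continuous real-valued functions on $X$), each with the topology of pointwise convergence. The following conditions are equivalent: 1. $X$ has property $(\kappa)$: every pairwise disjoint sequence $(F_n)_{n\in\mathbb{N}}$ of finite subsets of $X$ has a strongly point-finite subsequence $(F_{n_k})_{k\in\mathbb{N}}$, i.e. there are open sets $U_k\supseteq F_{n_k}$ such that every $x\in X$ belongs to $U_k$ for only finitely many $k$. 2. $C_p(X)$ is $\kappa$-Fréchet–Urysohn, where a space $Y$ is called $\kappa$-Fréchet–Urysohn if, for every open $U\subseteq Y$, every point of $\overline{U}$ is the limit of a sequence of points of $U$. 3. $C_p(X,[0,1])$ is $\kappa$-Fréchet–Urysohn. 4. $C_p(X)$ is an Ascoli space, where a space $Y$ is called Ascoli if, for every compact subset $K$ of the space $C_k(Y)$ of continuous real-valued functions on $Y$ with the compact-open topology, the evaluation map $K\times Y\to\mathbb{R}$, $(f,y)\mapsto f(y)$, is continuous. 5. $C_p(X)$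 does not have the Banakh property, where a space $Y$ has the Banakh property if there is a sequence $(A_n)_{n\in\mathbb{N}}$ of closed nowhere dense subsets of $Y$ such that every compact subset of $Y$ is contained in some $A_n$. 6. Every pairwise disjoint sequence $(F_n)_{n\in\mathbb{N}}$ of non-empty finite subsets of $X$ has a strongly $\mathrm{Coz}_\delta$-disjoint subsequence $(F_{n_k})_{k\in\mathbb{N}}$. That is, putting $S=\bigcup_{k} F_{n_k}$, there are pairwise disjoint sets $G_a\ni a$ $(a\in S)$ such that for every $B\subseteq S$ the union $\bigcup_{b\in B}G_b$ is a $\mathrm{Coz}_\delta$-set (a countable intersection of cozero sets of $X$); in particular, each $G_a$ is a $\mathrm{Coz}_\delta$-set. 7. $B_1(X)$ is a Baire space: the intersection of every sequence of dense open subsets of $B_1(X)$ is dense in $B_1(X)$. -/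

import Mathlib

open Set Filter Topology

/-- The space `C_p(X, Y)` of continuous maps `X → Y` with the topology of pointwise convergence
(the topology induced from the product `X → Y`). -/
abbrev Cp (X Y : Type*) [TopologicalSpace X] [TopologicalSpace Y] : Type _ :=
  {f : X → Y // Continuous f}

/-- `f` is a pointwise limit of a sequence of continuous real-valued functions on `X`. -/
def IsBaireOne {X : Type*} [TopologicalSpace X] (f : X → ℝ) : Prop :=
  ∃ g : ℕ → X → ℝ, (∀ n, Continuous (g n)) ∧ ∀ x, Tendsto (fun n => g n x) atTop (𝓝 (f x))

/-- The space `B₁(X)` of Baire-one real-valued functions with the topology of pointwise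
convergence (the topology induced from the product `X → ℝ`). -/
abbrev BaireOne (X : Type*) [TopologicalSpace X] : Type _ :=
  {f : X → ℝ // IsBaireOne f}

/-- Every point in the closure of an open set `U` is the limit of a sequence of points of `U`. -/
def IsKappaFrechetUrysohn (X : Type*) [TopologicalSpace X] : Prop :=
  ∀ U : Set X, IsOpen U → ∀ x ∈ closure U,
    ∃ u : ℕ → X, (∀ n, u n ∈ U) ∧ Tendsto u atTop (𝓝 x)

/-- Every point belongs to `A i` for only finitely many indices `i`. -/
def IsPointFinite {ι X : Type*} (A : ι → Set X) : Prop :=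
  ∀ x : X, {i : ι | x ∈ A i}.Finite

/-- The family has a point-finite open expansion. -/
def IsStronglyPointFinite {ι X : Type*} [TopologicalSpace X] (A : ι → Set X) : Prop :=
  ∃ U : ι → Set X, (∀ i, IsOpen (U i) ∧ A i ⊆ U i) ∧ IsPointFinite U

/-- Property `(κ)`: every pairwise disjoint sequence of finite subsets has a strongly point-finite
subsequence. -/
def HasPropertyKappa (X : Type*) [TopologicalSpace X] : Prop :=
  ∀ F : ℕ → Set X, (∀ n, (F n).Finite) → (Pairwise fun m n => Disjoint (F m) (F n)) →
    ∃ φ : ℕ → ℕ, StrictMono φ ∧ IsStronglyPointFinite fun k => F (φ k)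

/-- Every compact set `K` of `C_k(X)` (`C(X, ℝ)` with Mathlib's compact-open topology) is evenly
continuous: the evaluation map `K × X → ℝ` is (jointly) continuous. -/
def IsAscoliSpace (X : Type*) [TopologicalSpace X] : Prop :=
  ∀ K : Set C(X, ℝ), IsCompact K → Continuous fun p : K × X => (p.1 : C(X, ℝ)) p.2

/-- There is a sequence of closed nowhere dense sets such that every compact set is contained in
one of them. -/
def HasBanakhProperty (X : Type*) [TopologicalSpace X] : Prop :=
  ∃ A : ℕ → Set X, (∀ n, IsClosed (A n) ∧ IsNowhereDense (A n)) ∧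
    ∀ K : Set X, IsCompact K → ∃ n, K ⊆ A n

/-- The zero set of a continuous real-valued function. -/
def IsZeroSet {X : Type*} [TopologicalSpace X] (A : Set X) : Prop :=
  ∃ f : C(X, ℝ), A = f ⁻¹' {0}

/-- The complement of a zero set. -/
def IsCozeroSet {X : Type*} [TopologicalSpace X] (O : Set X) : Prop :=
  IsZeroSet Oᶜ

/-- A `Coz_δ`-set: a countable intersection of cozero sets. -/
def IsCozDelta {X : Type*} [TopologicalSpace X] (A : Set X) : Prop :=
  ∃ W : ℕ → Set X, (∀ n, IsCozeroSet (W n)) ∧ A = ⋂ n, W n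

/-- The points `a` of `A` have pairwise disjoint `Coz_δ` neighborhoods `F a` (`Coz_δ`-sets
containing `a`) which form a completely `Coz_δ`-additive system. -/
def IsStronglyCozDeltaDisjoint {X : Type*} [TopologicalSpace X] (A : Set X) : Prop :=
  ∃ F : A → Set X, (∀ a : A, IsCozDelta (F a) ∧ (a : X) ∈ F a) ∧
    (Pairwise fun a b : A => Disjoint (F a) (F b)) ∧
    ∀ B : Set A, IsCozDelta (⋃ b ∈ B, F b)

/-- A (disjoint) sequence of sets is strongly `Coz_δ`-disjoint if its union is. -/
def IsStronglyCozDeltaDisjointSeq {X : Type*} [TopologicalSpace X] (D : ℕ → Set X) : Prop :=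
  (Pairwise fun m n => Disjoint (D m) (D n)) ∧ IsStronglyCozDeltaDisjoint (⋃ n, D n)

/-! ### Continuous bumps, interpolation and local gluing -/

section Interpolation

variable {X : Type*} [TopologicalSpace X]

/-! A basic neighbourhood in the pointwise topology constrains finitely many points, and `(κ)`
speaks of disjoint finite sets.

Assume `(κ)`. Approximate a function by members of successive open sets, with finite sets `E n`
growing so that `E (n + 1)` certifies membership in the `n`-th open set. The increments `E (n + 1) \
E n` are disjoint, so a subsequence has a point-finite open expansion, and `exists_glue` confines
each correction, up to a small error, to its own open set. Every point sees finitely many large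
corrections, so the corrected functions converge (`HasPropertyKappa.exists_subseq_tendsto`);
accumulated corrections converge to a Baire-one function in all given dense open sets
(`HasPropertyKappa.exists_isBaireOne_mem`).

Conversely, continuous functions that are pointwise bounded, or pointwise null, but large on
infinitely many `F n` have superlevel sets giving a point-finite expansion. The `Coz_δ` condition is
matched with `(κ)` by set algebra. -/

theorem exists_bump [T35Space X] {F U : Set X} (hF : F.Finite) (hU : IsOpen U) (hFU : F ⊆ U) :
    ∃ p : X → ℝ, Continuous p ∧ (∀ x, 0 ≤ p x ∧ p x ≤ 1) ∧ (∀ x ∈ F, p x = 1) ∧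
      ∀ x ∉ U, p x = 0 := by
  have key : ∀ a : X, ∃ f : X → ℝ, Continuous f ∧ (∀ x, 0 ≤ f x ∧ f x ≤ 1) ∧
      (a ∈ U → f a = 0) ∧ ∀ x ∉ U, f x = 1 := by
    intro a
    by_cases ha : a ∈ U
    · obtain ⟨f, hf, h0, h1⟩ := CompletelyRegularSpace.completely_regular a Uᶜ hU.isClosed_compl
        (fun h => h ha)
      exact ⟨fun x => f x, by fun_prop, fun x => ⟨(f x).2.1, (f x).2.2⟩, fun _ => by simp [h0],
        fun x hx => by simp [h1 hx]⟩
    · exact ⟨fun _ => 1, by fun_prop, by simp, fun h => absurd h ha, by simp⟩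
  choose f hf hb h0 h1 using key
  refine ⟨fun x => 1 - ∏ a ∈ hF.toFinset, f a x, by fun_prop, fun x => ?_, fun x hx => ?_,
    fun x hx => ?_⟩
  · have h2 : 0 ≤ ∏ a ∈ hF.toFinset, f a x := Finset.prod_nonneg fun a _ => (hb a x).1
    have h3 : ∏ a ∈ hF.toFinset, f a x ≤ 1 :=
      Finset.prod_le_one (fun a _ => (hb a x).1) fun a _ => (hb a x).2
    constructor <;> linarith
  · have : ∏ a ∈ hF.toFinset, f a x = 0 :=
      Finset.prod_eq_zero (hF.mem_toFinset.2 hx) (h0 x (hFU hx))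
    simp [this]
  · have : ∏ a ∈ hF.toFinset, f a x = 1 := Finset.prod_eq_one fun a _ => h1 a x hx
    simp [this]

/-- Every real function agrees on a given finite set with a bounded continuous function. -/
theorem exists_interpolation [T35Space X] (E : Finset X) (v : X → ℝ) :
    ∃ g : X → ℝ, Continuous g ∧ (∃ M, ∀ x, |g x| ≤ M) ∧ ∀ x ∈ E, g x = v x := by
  classical
  have key : ∀ a : X, ∃ p : X → ℝ, Continuous p ∧ (∀ x, 0 ≤ p x ∧ p x ≤ 1) ∧ p a = 1 ∧
      ∀ x ∈ E, x ≠ a → p x = 0 := by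
    intro a
    obtain ⟨p, hp, hb, h1, h0⟩ := exists_bump (F := {a}) (U := (↑(E.erase a) : Set X)ᶜ)
      (finite_singleton a) (E.erase a).finite_toSet.isClosed.isOpen_compl (by simp)
    exact ⟨p, hp, hb, h1 a rfl, fun x hx hxa => h0 x (by simp [hx, hxa])⟩
  choose p hp hb h1 h0 using key
  refine ⟨fun x => ∑ a ∈ E, v a * p a x, by fun_prop, ⟨∑ a ∈ E, |v a|, fun x => ?_⟩, ?_⟩
  · refine (Finset.abs_sum_le_sum_abs _ _).trans (Finset.sum_le_sum fun a _ => ?_)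
    rw [abs_mul, abs_of_nonneg (hb a x).1]
    exact mul_le_of_le_one_right (abs_nonneg _) (hb a x).2
  · intro x hx
    change ∑ a ∈ E, v a * p a x = v x
    rw [Finset.sum_eq_single x]
    · rw [h1, mul_one]
    · intro a _ ha
      rw [h0 a x hx ha.symm, mul_zero]
    · exact fun h => absurd hx h

/-- Clamp `g` to the band of radius `ε` around `s`, then use a bump to pass from the clamp to `g`
itself near `F`. On `E` the clamp already equals `g`, so `E` may meet `U`. Staying between `s` and
`g` preserves bounds such as values in `[0,1]`. -/
theorem exists_glue [T35Space X] {s g : X → ℝ} (hs : Continuous s) (hg : Continuous g)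
    {E F U : Set X} {ε : ℝ} (hε : 0 ≤ ε) (hE : ∀ x ∈ E, |g x - s x| ≤ ε) (hF : F.Finite)
    (hU : IsOpen U) (hFU : F ⊆ U) :
    ∃ h : X → ℝ, Continuous h ∧ (∀ x, h x ∈ uIcc (s x) (g x)) ∧ (∀ x ∈ E ∪ F, h x = g x) ∧
      ∀ x ∉ U, |h x - s x| ≤ ε := by
  obtain ⟨p, hp, hb, h1, h0⟩ := exists_bump hF hU hFU
  set c : X → ℝ := fun x => max (s x - ε) (min (g x) (s x + ε)) with hc
  have hcc : Continuous c := by fun_prop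
  have hcE : ∀ x, |g x - s x| ≤ ε → c x = g x := by
    intro x hx
    rw [abs_le] at hx
    simp only [hc]
    rw [min_eq_left (by linarith), max_eq_right (by linarith)]
  have hcs : ∀ x, |c x - s x| ≤ ε := by
    intro x
    rw [abs_le]
    have h2 : s x - ε ≤ c x := le_max_left _ _
    have h3 : c x ≤ s x + ε := max_le (by linarith) (min_le_right _ _)
    constructor <;> linarith
  have hcu : ∀ x, c x ∈ uIcc (s x) (g x) := by
    intro x
    rw [mem_uIcc]
    simp only [hc]
    rcases le_total (s x) (g x) with h | h
    · left
      rw [max_eq_right (le_min (by linarith) (by linarith))]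
      exact ⟨le_min h (by linarith), min_le_left _ _⟩
    · right
      rw [min_eq_left (by linarith)]
      exact ⟨le_max_right _ _, max_le (by linarith) h⟩
  refine ⟨fun x => p x * g x + (1 - p x) * c x, by fun_prop, fun x => ?_, fun x hx => ?_,
    fun x hx => ?_⟩
  · have := (convex_uIcc (𝕜 := ℝ) (s x) (g x)) right_mem_uIcc (hcu x) (hb x).1
      (sub_nonneg.2 (hb x).2) (by ring)
    simpa using this
  · rcases hx with hx | hx
    · simp only [hcE x (hE x hx)]; ring
    · simp [h1 x hx]
  · simpa [h0 x hx] using hcs x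

end Interpolation

/-! ### Pointwise topologies, treated uniformly through an inducing map into `X → ℝ` -/

section PointwiseTopology

variable {X Z : Type*} [TopologicalSpace Z] {i : Z → X → ℝ}

theorem Topology.IsInducing.exists_finset_of_isOpen (hi : IsInducing i) {U : Set Z}
    (hU : IsOpen U) {z : Z} (hz : z ∈ U) :
    ∃ (E : Finset X) (ε : ℝ), 0 < ε ∧ ∀ w, (∀ x ∈ E, |i w x - i z x| < ε) → w ∈ U := by
  obtain ⟨V, hV, rfl⟩ := hi.isOpen_iff.1 hU
  obtain ⟨E, u, hu, hEV⟩ := isOpen_pi_iff.1 hV (i z) hz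
  have key : ∀ x : X, ∃ ε : ℝ, 0 < ε ∧ (x ∈ E → Metric.ball (i z x) ε ⊆ u x) := by
    intro x
    by_cases hx : x ∈ E
    · obtain ⟨ε, h, h'⟩ := Metric.isOpen_iff.1 (hu x hx).1 _ (hu x hx).2
      exact ⟨ε, h, fun _ => h'⟩
    · exact ⟨1, one_pos, fun h => absurd h hx⟩
  choose ε hε hb using key
  obtain ⟨δ, hδ, hδE⟩ : ∃ δ : ℝ, 0 < δ ∧ ∀ x ∈ E, δ ≤ ε x := by
    rcases E.eq_empty_or_nonempty with rfl | hE
    · exact ⟨1, one_pos, by simp⟩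
    · obtain ⟨x, _, hx⟩ := E.exists_min_image ε hE
      exact ⟨ε x, hε x, hx⟩
  refine ⟨E, δ, hδ, fun w hw => hEV fun x hx => hb x hx ?_⟩
  rw [Metric.mem_ball, Real.dist_eq]
  exact (hw x hx).trans_le (hδE x hx)

theorem Topology.IsInducing.isOpen_setOf_forall_abs_lt (hi : IsInducing i) (E : Finset X)
    (v : X → ℝ) (ε : ℝ) : IsOpen {w : Z | ∀ x ∈ E, |i w x - v x| < ε} := by
  have h : {w : Z | ∀ x ∈ E, |i w x - v x| < ε} = ⋂ x ∈ E, {w : Z | |i w x - v x| < ε} := by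
    ext; simp
  rw [h]
  refine isOpen_biInter_finset fun x _ => ?_
  have : Continuous fun w => i w x := (continuous_apply x).comp hi.continuous
  exact isOpen_lt (by fun_prop) continuous_const

theorem Topology.IsInducing.mem_closure_iff_finset (hi : IsInducing i) {U : Set Z} {z : Z} :
    z ∈ closure U ↔ ∀ (E : Finset X) (ε : ℝ), 0 < ε → ∃ w ∈ U, ∀ x ∈ E, |i w x - i z x| < ε := by
  rw [mem_closure_iff]
  constructor
  · intro h E ε hε
    obtain ⟨w, hw, hwU⟩ := h _ (hi.isOpen_setOf_forall_abs_lt E (i z) ε) (by simp [hε])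
    exact ⟨w, hwU, hw⟩
  · intro h O hO hz
    obtain ⟨E, ε, hε, hE⟩ := hi.exists_finset_of_isOpen hO hz
    obtain ⟨w, hw, hwE⟩ := h E ε hε
    exact ⟨w, hE w hwE, hw⟩

theorem Topology.IsInducing.isOpen_setOf_forall_lt (hi : IsInducing i) {F : Set X} (hF : F.Finite)
    (c : ℝ) : IsOpen {w : Z | ∀ x ∈ F, c < i w x} := by
  have h : {w : Z | ∀ x ∈ F, c < i w x} = ⋂ x ∈ F, {w : Z | c < i w x} := by
    ext; simp
  rw [h]
  refine hF.isOpen_biInter fun x _ => ?_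
  have : Continuous fun w => i w x := (continuous_apply x).comp hi.continuous
  exact isOpen_lt continuous_const this

end PointwiseTopology

/-! ### Disjoint sequences of finite sets -/

section DisjointFinite

variable {X : Type*}

theorem eventually_disjoint_of_pairwise_disjoint {F : ℕ → Set X}
    (hF : Pairwise fun m n => Disjoint (F m) (F n)) (E : Finset X) :
    ∀ᶠ n in atTop, Disjoint (F n) (E : Set X) := by
  have : ∀ x ∈ E, ∀ᶠ n in atTop, x ∉ F n := by
    intro x _
    by_cases h : ∃ m, x ∈ F m
    · obtain ⟨m, hm⟩ := h
      filter_upwards [eventually_gt_atTop m] with n hn hx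
      exact (hF hn.ne).le_bot ⟨hm, hx⟩
    · push Not at h
      exact Eventually.of_forall h
  filter_upwards [(E.eventually_all (l := atTop)).2 this] with n hn
  exact disjoint_right.2 fun x hx => hn x hx

end DisjointFinite

/-! ### Property `(κ)` and the κ-Fréchet–Urysohn property -/

section Kappa

variable {X : Type*} [TopologicalSpace X]

theorem HasPropertyKappa.exists_subseq_diff (hX : HasPropertyKappa X) {E : ℕ → Finset X}
    (hE : Monotone E) :
    ∃ φ : ℕ → ℕ, StrictMono φ ∧
      IsStronglyPointFinite fun k => (E (φ k + 1) : Set X) \ E (φ k) := by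
  refine hX (fun n => (E (n + 1) : Set X) \ E n) (fun n => (E (n + 1)).finite_toSet.sdiff) ?_
  refine (pairwise_disjoint_on _).2 fun m n hmn => disjoint_left.2 fun x hx hx' => hx'.2 ?_
  exact hE (Nat.succ_le_of_lt hmn) hx.1

theorem hasPropertyKappa_of_nonempty
    (h : ∀ F : ℕ → Set X, (∀ n, (F n).Finite ∧ (F n).Nonempty) →
      (Pairwise fun m n => Disjoint (F m) (F n)) →
        ∃ φ : ℕ → ℕ, StrictMono φ ∧ IsStronglyPointFinite fun k => F (φ k)) :
    HasPropertyKappa X := by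
  intro F hF hd
  by_cases he : ∃ᶠ n in atTop, F n = ∅
  · obtain ⟨φ, hφ, h0⟩ := extraction_of_frequently_atTop he
    exact ⟨φ, hφ, fun _ => ∅, fun k => ⟨isOpen_empty, (h0 k).subset⟩, fun x => by simp⟩
  · rw [not_frequently] at he
    obtain ⟨N, hN⟩ := eventually_atTop.1 he
    obtain ⟨φ, hφ, h'⟩ := h (fun n => F (n + N))
      (fun n => ⟨hF _, nonempty_iff_ne_empty.2 (hN _ (Nat.le_add_left _ _))⟩)
      (fun m n hmn => hd (by simpa using hmn))
    exact ⟨fun k => φ k + N, fun a b hab => Nat.add_lt_add_right (hφ hab) N, h'⟩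

/-- If infinitely many `F n` are such that some member of a pointwise bounded family of continuous
functions exceeds `n` on `F n`, then `F` has a strongly point-finite subsequence. -/
theorem exists_subseq_isStronglyPointFinite {F : ℕ → Set X} {C : Set (X → ℝ)}
    (hC : ∀ f ∈ C, Continuous f) (hb : ∀ x, BddAbove ((fun f : X → ℝ => f x) '' C))
    (h : ∃ᶠ n : ℕ in atTop, ∃ f ∈ C, ∀ x ∈ F n, (n : ℝ) < f x) :
    ∃ φ : ℕ → ℕ, StrictMono φ ∧ IsStronglyPointFinite fun k => F (φ k) := by
  obtain ⟨φ, hφ, h'⟩ := extraction_of_frequently_atTop h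
  choose f hfC hf using h'
  refine ⟨φ, hφ, fun k => {x | (φ k : ℝ) < f k x},
    fun k => ⟨isOpen_lt continuous_const (hC _ (hfC k)), hf k⟩, fun x => ?_⟩
  obtain ⟨M, hM⟩ := hb x
  refine (finite_le_nat ⌈M⌉₊).subset fun k hk => ?_
  have h1 : (φ k : ℝ) < M := lt_of_lt_of_le hk (hM (mem_image_of_mem _ (hfC k)))
  have h2 : (k : ℝ) ≤ φ k := by exact_mod_cast hφ.id_le k
  have h3 : (k : ℝ) ≤ ⌈M⌉₊ := by linarith [Nat.le_ceil M]
  exact_mod_cast h3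

variable [T35Space X] {Z : Type*} [TopologicalSpace Z] {i : Z → X → ℝ}

/-- The sets `O n` may vary: constant ones give the κ-Fréchet–Urysohn property, decreasing dense
ones refute the Banakh property. Hypothesis `hbet` returns glued functions to `Z`. -/
theorem HasPropertyKappa.exists_subseq_tendsto (hX : HasPropertyKappa X) (hi : IsInducing i)
    (hc : ∀ z, Continuous (i z))
    (hbet : ∀ z w (h : X → ℝ), Continuous h → (∀ x, h x ∈ uIcc (i z x) (i w x)) → ∃ u, i u = h)
    {O : ℕ → Set Z} (hO : ∀ n, IsOpen (O n)) {z : Z} (hz : ∀ n, z ∈ closure (O n)) :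
    ∃ (φ : ℕ → ℕ) (g : ℕ → Z), StrictMono φ ∧ (∀ k, g k ∈ O (φ k)) ∧ Tendsto g atTop (𝓝 z) := by
  classical
  -- Agreement with `w` on `E'` alone forces membership in `O n`; this leaves freedom to undo `w`
  -- elsewhere.
  have step : ∀ (n : ℕ) (E : Finset X), ∃ (w : Z) (E' : Finset X), E ⊆ E' ∧
      (∀ x ∈ E, |i w x - i z x| ≤ 1 / ((n : ℝ) + 1)) ∧
      ∀ u, (∀ x ∈ E', i u x = i w x) → u ∈ O n := by
    intro n E
    obtain ⟨w, hw, hwE⟩ := hi.mem_closure_iff_finset.1 (hz n) E (1 / ((n : ℝ) + 1))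
      (by positivity)
    obtain ⟨E', ε, hε, hE'⟩ := hi.exists_finset_of_isOpen (hO n) hw
    refine ⟨w, E ∪ E', Finset.subset_union_left, fun x hx => (hwE x hx).le, fun u hu => ?_⟩
    refine hE' u fun x hx => ?_
    rw [hu x (Finset.mem_union_right _ hx)]
    simpa using hε
  choose w E' hsub hclose hmem using step
  obtain ⟨E, hE⟩ : ∃ E : ℕ → Finset X, ∀ n, E (n + 1) = E' n (E n) :=
    ⟨fun n => Nat.rec ∅ E' n, fun _ => rfl⟩
  obtain ⟨φ, hφ, U, hU, hpf⟩ := hX.exists_subseq_diff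
    (monotone_nat_of_le_succ fun n => (hE n).symm ▸ hsub n (E n))
  have glue : ∀ k, ∃ u : Z, u ∈ O (φ k) ∧ ∀ x ∉ U k, |i u x - i z x| ≤ 1 / ((φ k : ℝ) + 1) := by
    intro k
    obtain ⟨h, hh, hu, hE1, hU1⟩ := exists_glue (hc z) (hc (w (φ k) (E (φ k))))
      (E := (E (φ k) : Set X)) (ε := 1 / ((φ k : ℝ) + 1)) (by positivity)
      (hclose (φ k) (E (φ k))) (E (φ k + 1)).finite_toSet.sdiff (hU k).1 (hU k).2
    obtain ⟨u, rfl⟩ := hbet _ _ h hh hu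
    refine ⟨u, hmem (φ k) (E (φ k)) u fun x hx => hE1 x ?_, hU1⟩
    rw [← hE] at hx
    by_cases hxE : x ∈ E (φ k)
    · exact Or.inl hxE
    · exact Or.inr ⟨hx, hxE⟩
  choose g hg hgU using glue
  refine ⟨φ, g, hφ, hg, ?_⟩
  rw [hi.tendsto_nhds_iff, tendsto_pi_nhds]
  intro x
  rw [tendsto_iff_dist_tendsto_zero]
  refine squeeze_zero' (Eventually.of_forall fun _ => dist_nonneg) ?_
    ((tendsto_one_div_add_atTop_nhds_zero_nat (𝕜 := ℝ)).comp hφ.tendsto_atTop)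
  have : ∀ᶠ k in atTop, x ∉ U k := by
    rw [← Nat.cofinite_eq_atTop]
    exact (hpf x).eventually_cofinite_notMem
  filter_upwards [this] with k hk
  exact hgU k x hk

theorem HasPropertyKappa.isKappaFrechetUrysohn (hX : HasPropertyKappa X) (hi : IsInducing i)
    (hc : ∀ z, Continuous (i z))
    (hbet : ∀ z w (h : X → ℝ), Continuous h → (∀ x, h x ∈ uIcc (i z x) (i w x)) →
      ∃ u, i u = h) : IsKappaFrechetUrysohn Z := by
  intro U hU z hz
  obtain ⟨φ, g, -, hg, hgt⟩ := hX.exists_subseq_tendsto hi hc hbet (O := fun _ => U)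
    (fun _ => hU) (fun _ => hz)
  exact ⟨g, hg, hgt⟩

theorem IsKappaFrechetUrysohn.hasPropertyKappa (hZ : IsKappaFrechetUrysohn Z) (hi : IsInducing i)
    (hc : ∀ z, Continuous (i z))
    (hsurj : ∀ h : X → ℝ, Continuous h → (∀ x, 0 ≤ h x ∧ h x ≤ 1) → ∃ u, i u = h) :
    HasPropertyKappa X := by
  refine hasPropertyKappa_of_nonempty fun F hF hd => ?_
  obtain ⟨z, hz⟩ := hsurj (fun _ => 0) continuous_const (by simp)
  -- A finite set `E` misses almost every `F n`, so a bump can be `1` on `F n` and `0` on `E`.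
  have hcl : z ∈ closure (⋃ n, {w : Z | ∀ x ∈ F n, 1 / 2 < i w x}) := by
    rw [hi.mem_closure_iff_finset]
    intro E ε hε
    obtain ⟨n, hn⟩ := (eventually_disjoint_of_pairwise_disjoint hd E).exists
    obtain ⟨p, hp, hb, h1, h0⟩ := exists_bump (hF n).1 E.finite_toSet.isClosed.isOpen_compl
      hn.subset_compl_right
    obtain ⟨w, rfl⟩ := hsurj p hp hb
    refine ⟨w, mem_iUnion.2 ⟨n, fun x hx => ?_⟩, fun x hx => ?_⟩
    · rw [h1 x hx]; norm_num
    · rw [h0 x (by simpa using hx), hz]; simpa using hε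
  obtain ⟨u, hu, hut⟩ := hZ _ (isOpen_iUnion fun n => hi.isOpen_setOf_forall_lt (hF n).1 _) z hcl
  simp only [mem_iUnion] at hu
  choose m hm using hu
  rw [hi.tendsto_nhds_iff, tendsto_pi_nhds] at hut
  have hev : ∀ x, ∀ᶠ j in atTop, i (u j) x < 1 / 2 := fun x =>
    (hut x).eventually_lt_const (by rw [hz]; norm_num)
  -- No index recurs infinitely often: `u j` exceeds `1 / 2` on the non-empty `F (m j)`, yet tends
  -- to `0` at each point.
  have hmt : Tendsto m atTop atTop := by
    refine tendsto_atTop.2 fun b => ?_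
    have : ∀ n ∈ Finset.range b, ∀ᶠ j in atTop, m j ≠ n := by
      intro n _
      obtain ⟨x, hx⟩ := (hF n).2
      filter_upwards [hev x] with j hj hjn
      exact lt_asymm hj (hm j x (by rwa [hjn]))
    filter_upwards [((Finset.range b).eventually_all (l := atTop)).2 this] with j hj
    by_contra hlt
    exact hj (m j) (Finset.mem_range.2 (not_le.1 hlt)) rfl
  obtain ⟨ψ, hψ, hmψ⟩ := strictMono_subseq_of_tendsto_atTop hmt
  refine ⟨m ∘ ψ, hmψ, fun k => {x | 1 / 2 < i (u (ψ k)) x},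
    fun k => ⟨isOpen_lt continuous_const (hc _), hm (ψ k)⟩, fun x => ?_⟩
  have h2 := hψ.tendsto_atTop.eventually (hev x)
  rw [← Nat.cofinite_eq_atTop] at h2
  refine (eventually_cofinite.1 h2).subset fun k hk => ?_
  exact not_lt.2 (le_of_lt hk)

end Kappa

/-! ### From κ-Fréchet–Urysohn to Ascoli -/

section Ascoli

theorem IsKappaFrechetUrysohn.isAscoliSpace {Y : Type*} [TopologicalSpace Y]
    (hY : IsKappaFrechetUrysohn Y) : IsAscoliSpace Y := by
  intro K hK
  -- It suffices that `K` is equicontinuous at each point. Otherwise a sequence `u n → y` witnesses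
  -- oscillation of some `f n ∈ K`, and convergence of the `f n` uniformly on the compact set formed
  -- by `y` and the `u n` is contradictory.
  have equi : ∀ (y : Y) (ε : ℝ), 0 < ε → ∀ᶠ y' in 𝓝 y, ∀ f ∈ K, |f y' - f y| ≤ ε := by
    intro y ε hε
    set U : Set Y := ⋃ f ∈ K, {y' | ε < |f y' - f y|} with hUdef
    have hUo : IsOpen U := isOpen_biUnion fun f _ => isOpen_lt continuous_const (by fun_prop)
    by_cases hy : y ∈ closure U
    · exfalso
      obtain ⟨u, hu, hut⟩ := hY U hUo y hy
      simp only [hUdef, mem_iUnion, exists_prop] at hu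
      choose f hfK hf using hu
      -- An ultrafilter finer than `atTop` replaces a convergent subsequence, since `K` need not be
      -- sequentially compact.
      obtain ⟨g, -, hg⟩ := hK.ultrafilter_le_nhds ((Ultrafilter.of atTop).map f)
        (by
          rw [le_principal_iff]
          exact Filter.mem_map.2 (Eventually.of_forall hfK))
      set l : Ultrafilter ℕ := Ultrafilter.of atTop
      have hl : (l : Filter ℕ) ≤ atTop := Ultrafilter.of_le atTop
      have hfg : Tendsto f l (𝓝 g) := hg
      rw [ContinuousMap.tendsto_iff_forall_isCompact_tendstoUniformlyOn] at hfg
      have hunif := Metric.tendstoUniformlyOn_iff.1 (hfg _ hut.isCompact_insert_range) (ε / 3)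
        (by positivity)
      have hgc : Tendsto (fun n => g (u n)) l (𝓝 (g y)) :=
        (g.continuous.tendsto y).comp (hut.mono_left hl)
      have hgn := Metric.tendsto_nhds.1 hgc (ε / 3) (by positivity)
      obtain ⟨n, h1, h2⟩ := (hunif.and hgn).exists
      have h3 := h1 (u n) (mem_insert_of_mem _ (mem_range_self n))
      have h4 := h1 y (mem_insert _ _)
      rw [Real.dist_eq, abs_lt] at h2 h3 h4
      have h5 : ε < |f n (u n) - f n y| := hf n
      rcases lt_abs.1 h5 with h | h <;> linarith [h2.1, h2.2, h3.1, h3.2, h4.1, h4.2]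
    · rw [mem_closure_iff_frequently, not_frequently] at hy
      filter_upwards [hy] with y' hy' f hf
      by_contra hlt
      exact hy' (mem_iUnion₂.2 ⟨f, hf, not_le.1 hlt⟩)
  rw [continuous_iff_continuousAt]
  rintro ⟨f, y⟩
  rw [ContinuousAt, Metric.tendsto_nhds]
  intro ε hε
  have h1 : ∀ᶠ p : K × Y in 𝓝 (f, y), |(p.1 : C(Y, ℝ)) p.2 - (p.1 : C(Y, ℝ)) y| ≤ ε / 2 := by
    have := (continuous_snd.tendsto (f, y)).eventually (equi y (ε / 2) (by positivity))
    filter_upwards [this] with p hp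
    exact hp _ p.1.2
  have hev : Continuous fun p : K × Y => (p.1 : C(Y, ℝ)) y :=
    (ContinuousEvalConst.continuous_eval_const y).comp
      (continuous_subtype_val.comp continuous_fst)
  have h2 := Metric.tendsto_nhds.1 (hev.tendsto (f, y)) (ε / 2) (by positivity)
  filter_upwards [h1, h2] with p hp1 hp2
  calc dist ((p.1 : C(Y, ℝ)) p.2) ((f : C(Y, ℝ)) y)
      ≤ dist ((p.1 : C(Y, ℝ)) p.2) ((p.1 : C(Y, ℝ)) y)
        + dist ((p.1 : C(Y, ℝ)) y) ((f : C(Y, ℝ)) y) := dist_triangle _ _ _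
    _ < ε / 2 + ε / 2 := add_lt_add_of_le_of_lt hp1 hp2
    _ = ε := by ring

end Ascoli

/-! ### `Coz_δ`-sets and strongly `Coz_δ`-disjoint sequences -/

section CozDelta

variable {X : Type*} [TopologicalSpace X]

theorem isCozeroSet_support (f : C(X, ℝ)) : IsCozeroSet {x | f x ≠ 0} :=
  ⟨f, by ext; simp⟩

theorem IsCozeroSet.isOpen {O : Set X} (h : IsCozeroSet O) : IsOpen O := by
  obtain ⟨f, hf⟩ := h
  rw [← isClosed_compl_iff, hf]
  exact isClosed_singleton.preimage f.continuous

theorem IsCozeroSet.union {A B : Set X} (hA : IsCozeroSet A) (hB : IsCozeroSet B) :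
    IsCozeroSet (A ∪ B) := by
  obtain ⟨f, hf⟩ := hA
  obtain ⟨g, hg⟩ := hB
  refine ⟨f * f + g * g, ?_⟩
  rw [compl_union, hf, hg]
  ext x
  simp [mul_self_add_mul_self_eq_zero]

theorem IsCozeroSet.iUnion {ι : Type*} [Countable ι] {A : ι → Set X}
    (hA : ∀ n, IsCozeroSet (A n)) : IsCozeroSet (⋃ n, A n) := by
  choose f hf using hA
  have := Encodable.ofCountable ι
  have hle : ∀ n x, ‖(1 / 2 : ℝ) ^ Encodable.encode n * min 1 |f n x|‖ ≤
      (1 / 2) ^ Encodable.encode n := by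
    intro n x
    rw [Real.norm_of_nonneg (by positivity)]
    exact mul_le_of_le_one_right (by positivity) (min_le_left _ _)
  refine ⟨⟨fun x => ∑' n, (1 / 2 : ℝ) ^ Encodable.encode n * min 1 |f n x|,
    continuous_tsum (fun n => by fun_prop) summable_geometric_two_encode hle⟩, ?_⟩
  ext x
  have hs : Summable fun n => (1 / 2 : ℝ) ^ Encodable.encode n * min 1 |f n x| :=
    Summable.of_norm_bounded summable_geometric_two_encode fun n => hle n x
  have h0 : ∀ n, x ∉ A n ↔ f n x = 0 := fun n => by
    rw [← mem_compl_iff, hf n]; rfl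
  simp only [mem_compl_iff, mem_iUnion, not_exists, h0, mem_preimage, mem_singleton_iff,
    ContinuousMap.coe_mk]
  rw [← hs.hasSum_iff, hasSum_zero_iff_of_nonneg fun n => by positivity, funext_iff]
  refine forall_congr' fun n => ?_
  constructor
  · intro h; simp [h]
  · intro h
    rcases mul_eq_zero.1 h with h | h
    · exact absurd h (by positivity)
    · by_contra hne
      have : 0 < min 1 |f n x| := lt_min one_pos (abs_pos.2 hne)
      exact this.ne' h

theorem IsCozeroSet.isCozDelta {O : Set X} (h : IsCozeroSet O) : IsCozDelta O :=
  ⟨fun _ => O, fun _ => h, (iInter_const O).symm⟩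

theorem IsCozeroSet.isCozDelta_compl {O : Set X} (h : IsCozeroSet O) : IsCozDelta Oᶜ := by
  obtain ⟨f, hf⟩ := h
  refine ⟨fun n => {x | (⟨fun x => max 0 (1 / ((n : ℝ) + 1) - |f x|), by fun_prop⟩ : C(X, ℝ)) x ≠ 0},
    fun n => isCozeroSet_support _, ?_⟩
  rw [hf]
  ext x
  simp only [mem_preimage, mem_singleton_iff, mem_iInter, mem_ofPred_eq, ContinuousMap.coe_mk]
  constructor
  · intro h n
    have h1 : (0 : ℝ) < 1 / ((n : ℝ) + 1) := by positivity
    rw [h, abs_zero, sub_zero, max_eq_right h1.le]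
    exact h1.ne'
  · intro h
    by_contra hne
    obtain ⟨n, hn⟩ := exists_nat_one_div_lt (abs_pos.2 hne)
    exact h n (max_eq_left (by linarith))

theorem IsCozDelta.iInter {ι : Type*} [Countable ι] {A : ι → Set X} (hA : ∀ n, IsCozDelta (A n)) :
    IsCozDelta (⋂ n, A n) := by
  choose W hW hAW using hA
  rcases isEmpty_or_nonempty ι with hι | hι
  · refine ⟨fun _ => univ, fun _ => ⟨1, by ext; simp⟩, by simp⟩
  · obtain ⟨e, he⟩ := exists_surjective_nat (ι × ℕ)
    refine ⟨fun n => W (e n).1 (e n).2, fun n => hW _ _, ?_⟩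
    rw [he.iInter_comp fun p : ι × ℕ => W p.1 p.2, iInter_congr hAW]
    ext x
    simp only [mem_iInter, Prod.forall]

theorem IsCozDelta.inter {A B : Set X} (hA : IsCozDelta A) (hB : IsCozDelta B) :
    IsCozDelta (A ∩ B) := by
  rw [inter_eq_iInter]
  exact IsCozDelta.iInter fun b => by cases b <;> assumption

theorem IsCozDelta.union_isCozeroSet {A B : Set X} (hA : IsCozDelta A) (hB : IsCozeroSet B) :
    IsCozDelta (A ∪ B) := by
  obtain ⟨W, hW, rfl⟩ := hA
  exact ⟨fun n => W n ∪ B, fun n => (hW n).union hB, iInter_union _ _⟩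

/-- A set `S`, enumerated by `e`, is strongly `Coz_δ`-disjoint if its points have a point-finite
family of cozero neighborhoods, each of which avoids the earlier points of `S`. -/
theorem isStronglyCozDeltaDisjoint_of_isPointFinite {S : Set X} {e : S → ℕ}
    (he : Function.Injective e) {V : S → Set X} (hV : ∀ a, IsCozeroSet (V a))
    (hmem : ∀ a : S, (a : X) ∈ V a) (hlt : ∀ a b : S, e a < e b → (a : X) ∉ V b)
    (hpf : IsPointFinite V) : IsStronglyCozDeltaDisjoint S := by
  have : Countable S := he.countable
  set L : S → Set X := fun a => ⋃ b : {b : S // e a < e b}, V b with hL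
  have hLc : ∀ a, IsCozeroSet (L a) := fun a => IsCozeroSet.iUnion fun b => hV b
  -- `G a` collects the points whose last neighbourhood is `V a`; point-finiteness ensures that a
  -- last one exists, so the `G a` partition `⋃ a, V a`.
  set G : S → Set X := fun a => V a ∩ (L a)ᶜ with hG
  have hdis : ∀ a b : S, e a < e b → Disjoint (G a) (G b) := fun a b hab =>
    disjoint_left.2 fun x hx hx' => hx.2 (mem_iUnion.2 ⟨⟨b, hab⟩, hx'.1⟩)
  have hpair : Pairwise fun a b : S => Disjoint (G a) (G b) := by
    intro a b hab
    rcases lt_or_gt_of_ne (he.ne hab) with h | h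
    · exact hdis a b h
    · exact (hdis b a h).symm
  have hex : ∀ x a, x ∈ V a → ∃ b, x ∈ G b := by
    intro x a hxa
    obtain ⟨b, hb, hmax⟩ := (hpf x).exists_maximalFor e _ ⟨a, hxa⟩
    refine ⟨b, hb, fun hx => ?_⟩
    obtain ⟨⟨c, hc⟩, hxc⟩ := mem_iUnion.1 hx
    exact hc.not_ge (hmax hxc hc.le)
  refine ⟨G, fun a => ⟨(hV a).isCozDelta.inter (hLc a).isCozDelta_compl, hmem a, fun hx => ?_⟩,
    hpair, fun B => ?_⟩
  · obtain ⟨⟨b, hb⟩, hab⟩ := mem_iUnion.1 hx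
    exact hlt a b hb hab
  -- `Coz_δ`-sets are stable under countable intersections, so the union is rewritten by removing
  -- the cells outside `B`.
  · have hB : (⋃ b ∈ B, G b) = (⋃ a, V a) ∩ ⋂ b : (Bᶜ : Set S), ((V b)ᶜ ∪ L b) := by
      ext x
      simp only [mem_iUnion, mem_inter_iff, mem_iInter, exists_prop]
      constructor
      · rintro ⟨b, hb, hx⟩
        refine ⟨⟨b, hx.1⟩, fun c => ?_⟩
        by_contra hn
        simp only [mem_union, mem_compl_iff, not_or, not_not] at hn
        have hbc : b ≠ c := fun h => c.2 (h ▸ hb)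
        exact (hpair hbc).le_bot ⟨hx, hn⟩
      · rintro ⟨⟨a, ha⟩, h⟩
        obtain ⟨b, hb⟩ := hex x a ha
        refine ⟨b, ?_, hb⟩
        by_contra hbB
        rcases h ⟨b, hbB⟩ with h | h
        · exact h hb.1
        · exact hb.2 h
    rw [hB]
    exact (IsCozeroSet.iUnion hV).isCozDelta.inter
      (IsCozDelta.iInter fun b => (hV b).isCozDelta_compl.union_isCozeroSet (hLc b))

theorem HasPropertyKappa.exists_subseq_isStronglyCozDeltaDisjointSeq [T35Space X]
    (hX : HasPropertyKappa X) {F : ℕ → Set X} (hF : ∀ n, (F n).Finite)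
    (hd : Pairwise fun m n => Disjoint (F m) (F n)) :
    ∃ φ : ℕ → ℕ, StrictMono φ ∧ IsStronglyCozDeltaDisjointSeq fun k => F (φ k) := by
  obtain ⟨φ, hφ, U, hU, hpf⟩ := hX F hF hd
  refine ⟨φ, hφ, fun a b hab => hd (hφ.injective.ne hab), ?_⟩
  set S : Set X := ⋃ k, F (φ k) with hS
  have hSc : Countable S := (countable_iUnion fun k => (hF (φ k)).countable).to_subtype
  obtain ⟨e, he⟩ := exists_injective_nat S
  have hk : ∀ a : S, ∃ k, (a : X) ∈ F (φ k) := fun a => mem_iUnion.1 a.2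
  choose k hk using hk
  have bump : ∀ a : S, ∃ p : C(X, ℝ), p a ≠ 0 ∧ (∀ x ∉ U (k a), p x = 0) ∧
      ∀ b : S, e b < e a → p b = 0 := by
    intro a
    have hfin : {b : S | e b < e a}.Finite := (finite_lt_nat (e a)).preimage he.injOn
    have hE : ((↑) '' {b : S | e b < e a} : Set X).Finite := hfin.image _
    obtain ⟨p, hp, -, h1, h0⟩ := exists_bump (finite_singleton (a : X))
      ((hU (k a)).1.inter hE.isClosed.isOpen_compl) (by
        rw [singleton_subset_iff]
        refine ⟨(hU (k a)).2 (hk a), ?_⟩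
        rintro ⟨b, hb, hba⟩
        rw [Subtype.coe_injective hba] at hb
        exact lt_irrefl (e a) hb)
    refine ⟨⟨p, hp⟩, by simp [h1 a rfl], fun x hx => h0 x fun h => hx h.1,
      fun b hb => h0 b fun h => h.2 ⟨b, hb, rfl⟩⟩
  choose p hpa hpU hpb using bump
  refine isStronglyCozDeltaDisjoint_of_isPointFinite he (V := fun a => {x | p a x ≠ 0})
    (fun a => isCozeroSet_support (p a)) hpa (fun a b hab => not_not.2 (hpb b a hab)) fun x => ?_
  have hfin : (⋃ j ∈ {j | x ∈ U j}, (↑) ⁻¹' F (φ j) : Set S).Finite :=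
    (hpf x).biUnion fun j _ => (hF (φ j)).preimage Subtype.coe_injective.injOn
  refine hfin.subset fun a ha => mem_iUnion₂.2 ⟨k a, ?_, hk a⟩
  by_contra hx
  exact ha (hpU a x hx)

/-- The tails `⋃ b ∈ B k, G b` decrease to the empty set and are intersections of open sets `W k l`.
The finite intersection of the `W j l` with `j, l ≤ k` still contains `D k`, and a point outside
some `W j l` is lost for all `k ≥ max j l`. -/
theorem IsStronglyCozDeltaDisjointSeq.isStronglyPointFinite {D : ℕ → Set X}
    (h : IsStronglyCozDeltaDisjointSeq D) : IsStronglyPointFinite D := by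
  obtain ⟨hd, G, hG, hpair, hadd⟩ := h
  set B : ℕ → Set ↥(⋃ n, D n) := fun k => {a | ∃ j ≥ k, (a : X) ∈ D j} with hB
  choose W hW hBW using fun k => hadd (B k)
  refine ⟨fun k => ⋂ j ∈ Finset.range (k + 1), ⋂ l ∈ Finset.range (k + 1), W j l,
    fun k => ⟨isOpen_biInter_finset fun j _ => isOpen_biInter_finset fun l _ => (hW j l).isOpen,
      fun x hx => ?_⟩, fun x => ?_⟩
  · refine mem_iInter₂.2 fun j hj => mem_iInter₂.2 fun l _ => ?_
    have h1 : x ∈ ⋃ b ∈ B j, G b :=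
      mem_iUnion₂.2 ⟨⟨x, mem_iUnion.2 ⟨k, hx⟩⟩,
        ⟨k, Nat.lt_succ_iff.1 (Finset.mem_range.1 hj), hx⟩, (hG _).2⟩
    rw [hBW] at h1
    exact mem_iInter.1 h1 l
  · obtain ⟨j, hj⟩ : ∃ j, x ∉ ⋃ b ∈ B j, G b := by
      by_contra hall
      push Not at hall
      obtain ⟨a, -, ha⟩ := mem_iUnion₂.1 (hall 0)
      obtain ⟨m, hm⟩ := mem_iUnion.1 a.2
      obtain ⟨b, ⟨n, hn, hbn⟩, hb⟩ := mem_iUnion₂.1 (hall (m + 1))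
      have hab : a = b := by
        by_contra hne
        exact (hpair hne).le_bot ⟨ha, hb⟩
      subst hab
      have hmn : m ≠ n := by omega
      exact (hd hmn).le_bot ⟨hm, hbn⟩
    rw [hBW, mem_iInter, not_forall] at hj
    obtain ⟨l, hl⟩ := hj
    refine (finite_lt_nat (max j l)).subset fun k hk => ?_
    by_contra hlt
    have hjl : j ≤ k ∧ l ≤ k := max_le_iff.1 (not_lt.1 hlt)
    exact hl (mem_iInter₂.1 (mem_iInter₂.1 hk j (Finset.mem_range_succ_iff.2 hjl.1)) l
      (Finset.mem_range_succ_iff.2 hjl.2))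

end CozDelta

/-! ### Necessity of `(κ)`: Banakh, Ascoli and Baire -/

section NecessityOfKappa

variable {X : Type*} [TopologicalSpace X]

/-- A continuous function can be changed off a given finite set so as to be large on some
late member of a disjoint sequence of finite sets. -/
theorem exists_continuous_eqOn_lt [T35Space X] {F : ℕ → Set X} (hF : ∀ n, (F n).Finite)
    (hd : Pairwise fun m n => Disjoint (F m) (F n)) (f : X → ℝ) (E : Finset X) (N : ℕ) :
    ∃ n ≥ N, ∃ g : X → ℝ, Continuous g ∧ (∀ x ∈ E, g x = f x) ∧ ∀ x ∈ F n, g x = n + 1 := by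
  classical
  obtain ⟨n, hn, hnN⟩ := ((eventually_disjoint_of_pairwise_disjoint hd E).and
    (eventually_ge_atTop N)).exists
  obtain ⟨g, hg, -, hgE⟩ := exists_interpolation (E ∪ (hF n).toFinset)
    (fun x => if x ∈ E then f x else n + 1)
  refine ⟨n, hnN, g, hg, fun x hx => ?_, fun x hx => ?_⟩
  · rw [hgE x (by simp [hx]), if_pos hx]
  · rw [hgE x (by simp [hx]), if_neg fun h : x ∈ E => disjoint_left.1 hn hx h]

theorem bddAbove_eval_of_isCompact {C : Set (Cp X ℝ)} (hC : IsCompact C) (x : X) :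
    BddAbove ((fun f : X → ℝ => f x) '' (Subtype.val '' C)) := by
  rw [image_image]
  exact (hC.image ((continuous_apply x).comp continuous_subtype_val)).bddAbove

/-- Compactness enters only through pointwise boundedness: a compact set meeting infinitely many of
the open sets "`f > n` on `F n`" would yield a strongly point-finite subsequence. -/
theorem eventually_disjoint_of_isCompact {F : ℕ → Set X}
    (h : ¬ ∃ φ : ℕ → ℕ, StrictMono φ ∧ IsStronglyPointFinite fun k => F (φ k))
    {C : Set (Cp X ℝ)} (hC : IsCompact C) :
    ∀ᶠ n : ℕ in atTop, ∀ f ∈ C, ∃ x ∈ F n, f.1 x ≤ n := by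
  by_contra hne
  rw [not_eventually] at hne
  refine h (exists_subseq_isStronglyPointFinite (C := Subtype.val '' C) ?_
    (bddAbove_eval_of_isCompact hC) ?_)
  · rintro _ ⟨f, -, rfl⟩
    exact f.2
  · refine hne.mono fun n hn => ?_
    push Not at hn
    obtain ⟨f, hf, hx⟩ := hn
    exact ⟨f.1, mem_image_of_mem _ hf, hx⟩

theorem hasPropertyKappa_of_not_hasBanakhProperty [T35Space X] (h : ¬ HasBanakhProperty (Cp X ℝ)) :
    HasPropertyKappa X := by
  intro F hF hd
  by_contra hno
  refine h ⟨fun n => (⋃ m ≥ n, {f : Cp X ℝ | ∀ x ∈ F m, (m : ℝ) < f.1 x})ᶜ, fun n => ?_,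
    fun K hK => ?_⟩
  · have hi : IsInducing (Subtype.val : Cp X ℝ → X → ℝ) := IsInducing.subtypeVal
    have hcl : IsClosed (⋃ m ≥ n, {f : Cp X ℝ | ∀ x ∈ F m, (m : ℝ) < f.1 x})ᶜ :=
      (isOpen_biUnion fun m _ => hi.isOpen_setOf_forall_lt (hF m) _).isClosed_compl
    refine ⟨hcl, hcl.isNowhereDense_iff.2 ?_⟩
    rw [interior_compl, compl_empty_iff, eq_univ_iff_forall]
    intro f
    rw [hi.mem_closure_iff_finset]
    intro E ε hε
    obtain ⟨m, hm, g, hg, hgE, hgF⟩ := exists_continuous_eqOn_lt hF hd f.1 E n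
    refine ⟨⟨g, hg⟩, mem_iUnion₂.2 ⟨m, hm, fun x hx => ?_⟩, fun x hx => ?_⟩
    · simp [hgF x hx]
    · simpa [hgE x hx] using hε
  · obtain ⟨n, hn⟩ := eventually_atTop.1 (eventually_disjoint_of_isCompact hno hK)
    refine ⟨n, fun f hf hU => ?_⟩
    obtain ⟨m, hm, hfm⟩ := mem_iUnion₂.1 hU
    obtain ⟨x, hx, hle⟩ := hn m hm f hf
    exact (hfm x hx).not_ge hle

theorem IsAscoliSpace.hasPropertyKappa [T35Space X] (h : IsAscoliSpace (Cp X ℝ)) : HasPropertyKappa X := by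
  intro F hF hd
  by_contra hno
  have hi : IsInducing (Subtype.val : Cp X ℝ → X → ℝ) := IsInducing.subtypeVal
  have hev : ∀ x, Continuous fun f : Cp X ℝ => f.1 x := fun x =>
    (continuous_apply x).comp continuous_subtype_val
  -- `p n` vanishes unless `f > n` on all of `F n`, and is `1` once `f ≥ n + 1` there. Hence `p n →
  -- 0` uniformly on compact sets, although every neighbourhood of the zero function contains points
  -- where late `p n` equal `1`.
  let p : ℕ → C(Cp X ℝ, ℝ) := fun n =>
    ⟨fun f => ∏ x ∈ (hF n).toFinset, max 0 (min 1 (f.1 x - n)),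
      continuous_finsetProd _ fun x _ =>
        continuous_const.max (continuous_const.min ((hev x).sub continuous_const))⟩
  have hp : ∀ n f, p n f = ∏ x ∈ (hF n).toFinset, max 0 (min 1 (f.1 x - n)) := fun _ _ => rfl
  have hlim : Tendsto p atTop (𝓝 0) := by
    rw [ContinuousMap.tendsto_iff_forall_isCompact_tendstoUniformlyOn]
    intro C hC
    rw [Metric.tendstoUniformlyOn_iff]
    intro ε hε
    filter_upwards [eventually_disjoint_of_isCompact hno hC] with n hn f hf
    obtain ⟨x, hx, hle⟩ := hn f hf
    have : p n f = 0 := by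
      rw [hp]
      refine Finset.prod_eq_zero ((hF n).mem_toFinset.2 hx) (max_eq_left ?_)
      exact (min_le_right _ _).trans (by linarith)
    rw [this]
    simpa using hε
  have hK := h _ hlim.isCompact_insert_range
  have hc0 : Continuous fun _ : X => (0 : ℝ) := continuous_const
  have hnear := (hK.tendsto (⟨0, mem_insert _ _⟩, ⟨_, hc0⟩)).eventually_lt_const
    (u := 1) (by simp)
  rw [nhds_prod_eq] at hnear
  obtain ⟨P, hP, Q, hQ, hPQ⟩ := eventually_prod_iff.1 hnear
  have hPn : ∀ᶠ n in atTop, P ⟨p n, mem_insert_of_mem _ (mem_range_self n)⟩ := by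
    refine Tendsto.eventually ?_ hP
    exact tendsto_subtype_rng.2 hlim
  obtain ⟨N, hN⟩ := eventually_atTop.1 hPn
  obtain ⟨O, hOQ, hO, h0⟩ := eventually_nhds_iff.1 hQ
  obtain ⟨E, ε, hε, hE⟩ := hi.exists_finset_of_isOpen hO h0
  obtain ⟨n, hn, g, hg, hgE, hgF⟩ := exists_continuous_eqOn_lt hF hd (fun _ => 0) E N
  have hlt : p n ⟨g, hg⟩ < 1 :=
    hPQ (hN n hn) (hOQ ⟨g, hg⟩ (hE _ fun x hx => by simpa [hgE x hx] using hε))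
  refine hlt.ne ?_
  rw [hp]
  refine Finset.prod_eq_one fun x hx => ?_
  simp [hgF x ((hF n).mem_toFinset.1 hx)]

theorem IsBaireOne.of_continuous {f : X → ℝ} (hf : Continuous f) : IsBaireOne f :=
  ⟨fun _ => f, fun _ => hf, fun _ => tendsto_const_nhds⟩

theorem hasPropertyKappa_of_baireSpace [T35Space X] [BaireSpace (BaireOne X)] : HasPropertyKappa X := by
  intro F hF hd
  have hi : IsInducing (Subtype.val : BaireOne X → X → ℝ) := IsInducing.subtypeVal
  -- A generic `f` exceeds `m` on `F m` for infinitely many `m`. As `F m` is finite, a continuous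
  -- term of a sequence converging to `f` does so too, and that sequence is pointwise bounded.
  have hdense : Dense (⋂ n : ℕ, ⋃ m ≥ n, {f : BaireOne X | ∀ x ∈ F m, (m : ℝ) < f.1 x}) := by
    refine dense_iInter_of_isOpen_nat
      (fun n => isOpen_biUnion fun m _ => hi.isOpen_setOf_forall_lt (hF m) _) fun n f => ?_
    rw [hi.mem_closure_iff_finset]
    intro E ε hε
    obtain ⟨m, hm, g, hg, hgE, hgF⟩ := exists_continuous_eqOn_lt hF hd f.1 E n
    refine ⟨⟨g, IsBaireOne.of_continuous hg⟩, mem_iUnion₂.2 ⟨m, hm, fun x hx => ?_⟩,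
      fun x hx => ?_⟩
    · simp [hgF x hx]
    · simpa [hgE x hx] using hε
  have : Nonempty (BaireOne X) := ⟨⟨fun _ => 0, IsBaireOne.of_continuous continuous_const⟩⟩
  obtain ⟨f, hf⟩ := hdense.nonempty
  obtain ⟨g, hg, hgf⟩ := f.2
  refine exists_subseq_isStronglyPointFinite (C := range g) (by rintro _ ⟨n, rfl⟩; exact hg n)
    (fun x => ?_) (frequently_atTop.2 fun n => ?_)
  · rw [← range_comp]
    exact (hgf x).bddAbove_range
  · obtain ⟨m, hm, hfm⟩ := mem_iUnion₂.1 (mem_iInter.1 hf n)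
    have hev : ∀ᶠ j in atTop, ∀ x ∈ F m, (m : ℝ) < g j x :=
      ((hF m).eventually_all (l := atTop)).2 fun x hx => (hgf x).eventually_const_lt (hfm x hx)
    obtain ⟨j, hj⟩ := hev.exists
    exact ⟨m, hm, g j, mem_range_self j, hj⟩

end NecessityOfKappa

/-! ### `(κ)` excludes the Banakh property -/

section NotBanakh

variable {X : Type*} [TopologicalSpace X]

theorem dense_biInter_range_succ {Y : Type*} [TopologicalSpace Y] {D : ℕ → Set Y}
    (ho : ∀ n, IsOpen (D n)) (hd : ∀ n, Dense (D n)) (n : ℕ) :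
    Dense (⋂ m ∈ Finset.range (n + 1), D m) := by
  induction n with
  | zero => simpa using hd 0
  | succ n ih =>
    rw [Finset.range_add_one, Finset.set_biInter_insert]
    exact (hd _).inter_of_isOpen_left ih (ho _)

theorem HasPropertyKappa.not_hasBanakhProperty [T35Space X] (hX : HasPropertyKappa X) :
    ¬ HasBanakhProperty (Cp X ℝ) := by
  rintro ⟨A, hA, hK⟩
  have hopen : ∀ n, IsOpen (⋂ m ∈ Finset.range (n + 1), (A m)ᶜ) := fun n =>
    isOpen_biInter_finset fun m _ => (hA m).1.isOpen_compl
  have hdense : ∀ n, Dense (⋂ m ∈ Finset.range (n + 1), (A m)ᶜ) :=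
    dense_biInter_range_succ (fun n => (hA n).1.isOpen_compl) fun n =>
      interior_eq_empty_iff_dense_compl.1 ((hA n).1.isNowhereDense_iff.1 (hA n).2)
  obtain ⟨φ, g, hφ, hg, hgt⟩ := hX.exists_subseq_tendsto IsInducing.subtypeVal
    (fun z : Cp X ℝ => z.2) (fun _ _ h hh _ => ⟨⟨h, hh⟩, rfl⟩) hopen
    (z := ⟨fun _ => 0, continuous_const⟩) (fun n => hdense n _)
  -- The convergent sequence with its limit is compact, hence inside one `A n`; but `g n` avoids `A
  -- m` for all `m ≤ φ n`, and `n ≤ φ n`.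
  obtain ⟨n, hn⟩ := hK _ hgt.isCompact_insert_range
  refine mem_iInter₂.1 (hg n) n ?_ (hn (mem_insert_of_mem _ (mem_range_self n)))
  exact Finset.mem_range_succ_iff.2 (hφ.id_le n)

end NotBanakh

/-! ### `(κ)` makes the Baire-one functions a Baire space -/

section Baire

variable {X : Type*} [TopologicalSpace X]

/-- One finite set `E'` carries, for every function `w` bounded by `M`, a basic open subset of the
dense open set `D` that is `ε`-close to `w` on `E`. -/
theorem exists_finset_of_dense_baireOne [T35Space X] {D : Set (BaireOne X)} (hD : IsOpen D)
    (hd : Dense D) (E : Finset X) (M : ℝ) {ε : ℝ} (hε : 0 < ε) :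
    ∃ E' : Finset X, E ⊆ E' ∧ ∀ w : X → ℝ, (∀ x, |w x| ≤ M) →
      ∃ (g : X → ℝ) (δ : ℝ), 0 < δ ∧ (∀ x ∈ E, |g x - w x| ≤ ε) ∧
        ∀ f : BaireOne X, (∀ x ∈ E', |f.1 x - g x| ≤ δ) → f ∈ D := by
  classical
  have hi : IsInducing (Subtype.val : BaireOne X → X → ℝ) := IsInducing.subtypeVal
  have key : ∀ v : X → ℝ, ∃ (g : X → ℝ) (δ : ℝ) (E' : Finset X), 0 < δ ∧
      (∀ x ∈ E, |g x - v x| < ε / 2) ∧ ∀ f : BaireOne X, (∀ x ∈ E', |f.1 x - g x| ≤ δ) → f ∈ D := by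
    intro v
    obtain ⟨c, hc, -, hcv⟩ := exists_interpolation E v
    obtain ⟨g, hg, hgE⟩ := hi.mem_closure_iff_finset.1 (hd ⟨c, .of_continuous hc⟩) E (ε / 2)
      (by positivity)
    obtain ⟨E', δ, hδ, hE'⟩ := hi.exists_finset_of_isOpen hD hg
    refine ⟨g.1, δ / 2, E', by positivity, fun x hx => ?_, fun f hf => hE' f fun x hx => ?_⟩
    · rw [← hcv x hx]; exact hgE x hx
    · exact (hf x hx).trans_lt (by linarith)
  choose g δ E' hδ hgE hD' using key
  -- Compactness of `[-M, M]^X` leaves finitely many patterns `v` to treat, so `E'` does not depend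
  -- on `w`. This is needed because the finite sets must be fixed before `(κ)` selects a
  -- subsequence, while `w` depends on that subsequence.
  have hcomp : IsCompact (univ.pi fun _ : X => Icc (-M) M) :=
    isCompact_univ_pi fun _ => isCompact_Icc
  obtain ⟨t, -, ht⟩ := hcomp.elim_nhds_subcover
    (fun v => {w : X → ℝ | ∀ x ∈ E, |w x - v x| < ε / 2}) fun v _ =>
      ((IsInducing.id (X := X → ℝ)).isOpen_setOf_forall_abs_lt E v (ε / 2)).mem_nhds
        (by simp [hε])
  refine ⟨E ∪ t.biUnion E', Finset.subset_union_left, fun w hw => ?_⟩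
  obtain ⟨v, hv, hwv⟩ := mem_iUnion₂.1 (ht fun x _ => abs_le.1 (hw x))
  refine ⟨g v, δ v, hδ v, fun x hx => ?_, fun f hf => hD' v f fun x hx => hf x ?_⟩
  · have h1 := abs_lt.1 (hgE v x hx)
    have h2 := abs_lt.1 (hwv x hx)
    rw [abs_le]
    constructor <;> linarith [h1.1, h1.2, h2.1, h2.2]
  · exact Finset.mem_union_right _ (Finset.mem_biUnion.2 ⟨v, hv, hx⟩)

/-- The bound telescopes, since `η j / 2 ≤ η j - η (j + 1)`. -/
theorem abs_sub_le_of_geometric {a η : ℕ → ℝ} {J : ℕ}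
    (hη : ∀ j, 0 ≤ η j ∧ η (j + 1) ≤ η j / 2) (ha : ∀ j ≥ J, |a (j + 1) - a j| ≤ η j / 2) :
    ∀ l ≥ J, |a l - a J| ≤ η J := by
  have h : ∀ l ≥ J, |a l - a J| ≤ η J - η l := by
    intro l hl
    induction l, hl using Nat.le_induction with
    | base => simp
    | succ l hl ih =>
      have h1 := abs_sub_le (a (l + 1)) (a l) (a J)
      linarith [ha l hl, (hη l).2]
  exact fun l hl => (h l hl).trans (by linarith [(hη l).1])

theorem exists_tendsto_of_geometric {a η : ℕ → ℝ}
    (hη : ∀ j, 0 ≤ η j ∧ η (j + 1) ≤ η j / 2)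
    (ha : ∀ᶠ j in atTop, |a (j + 1) - a j| ≤ η j / 2) : ∃ b, Tendsto a atTop (𝓝 b) := by
  obtain ⟨J, hJ⟩ := eventually_atTop.1 ha
  have hgeo : ∀ j, η j ≤ η 0 * (1 / 2) ^ j := by
    intro j
    induction j with
    | zero => simp
    | succ j ih => rw [pow_succ]; linarith [(hη j).2]
  have hη0 : Tendsto η atTop (𝓝 0) := by
    refine squeeze_zero (fun j => (hη j).1) hgeo ?_
    simpa using (tendsto_pow_atTop_nhds_zero_of_lt_one (by norm_num : (0 : ℝ) ≤ 1 / 2)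
      (by norm_num)).const_mul (η 0)
  have hc : CauchySeq fun j => a (j + J) := by
    refine cauchySeq_of_le_tendsto_0 (fun N => 2 * η (N + J)) (fun n m N hn hm => ?_) ?_
    · have h := fun l hl => abs_sub_le_of_geometric (J := N + J) hη
        (fun j hj => hJ j (by omega)) l hl
      have h1 := abs_le.1 (h (n + J) (by omega))
      have h2 := abs_le.1 (h (m + J) (by omega))
      rw [Real.dist_eq, abs_le]
      constructor <;> linarith [h1.1, h1.2, h2.1, h2.2]
    · simpa using ((tendsto_add_atTop_iff_nat J).2 hη0).const_mul 2
  obtain ⟨b, hb⟩ := cauchySeq_tendsto_of_complete hc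
  exact ⟨b, (tendsto_add_atTop_iff_nat J).1 hb⟩

theorem HasPropertyKappa.exists_isBaireOne_mem [T35Space X] (hX : HasPropertyKappa X)
    {D : ℕ → Set (BaireOne X)} (ho : ∀ n, IsOpen (D n)) (hd : ∀ n, Dense (D n))
    (hD : Antitone D) {s₀ : X → ℝ} (hs₀ : Continuous s₀) (hb₀ : ∃ M, ∀ x, |s₀ x| ≤ M)
    (E₀ : Finset X) {η₀ : ℝ} (hη₀ : 0 < η₀) :
    ∃ f : BaireOne X, (∀ x ∈ E₀, |f.1 x - s₀ x| ≤ η₀) ∧ ∀ n, f ∈ D n := by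
  -- The index `n` also serves as the bound on `w`; each bounded function is covered once `n` is
  -- large.
  choose E' hsub hE' using fun (n : ℕ) (E : Finset X) =>
    exists_finset_of_dense_baireOne (ho n) (hd n) E n (ε := 1 / ((n : ℝ) + 1)) (by positivity)
  obtain ⟨E, hE0, hE⟩ : ∃ E : ℕ → Finset X, E 0 = E₀ ∧ ∀ n, E (n + 1) = E' n (E n) :=
    ⟨fun n => Nat.rec E₀ E' n, rfl, fun _ => rfl⟩
  have hmono : Monotone E := monotone_nat_of_le_succ fun n => (hE n).symm ▸ hsub n (E n)
  obtain ⟨φ, hφ, U, hU, hpf⟩ := hX.exists_subseq_diff hmono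
  -- A stage holds an index into the subsequence, a bounded continuous approximant and the total
  -- movement still allowed.
  let St := {p : ℕ × (X → ℝ) × ℝ // Continuous p.2.1 ∧ (∃ M, ∀ x, |p.2.1 x| ≤ M) ∧ 0 < p.2.2}
  have step : ∀ p : St, ∃ q : St, p.1.1 < q.1.1 ∧ q.1.2.2 ≤ p.1.2.2 / 2 ∧
      (∀ x, (x ∈ E (φ q.1.1) ∨ x ∉ U q.1.1) → |q.1.2.1 x - p.1.2.1 x| ≤ p.1.2.2 / 2) ∧
      ∀ f : BaireOne X, (∀ x ∈ E (φ q.1.1 + 1), |f.1 x - q.1.2.1 x| ≤ q.1.2.2) →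
        f ∈ D (φ q.1.1) := by
    rintro ⟨⟨k, s, η⟩, hs, ⟨M, hM⟩, hη⟩
    dsimp only at hs hM hη ⊢
    have hφt : Tendsto (fun j => (φ j : ℝ)) atTop atTop :=
      tendsto_natCast_atTop_atTop.comp hφ.tendsto_atTop
    have hsmall := (tendsto_one_div_add_atTop_nhds_zero_nat (𝕜 := ℝ)).comp hφ.tendsto_atTop
    obtain ⟨k', hk', hMk, hηk⟩ := ((eventually_gt_atTop k).and
      ((hφt.eventually_ge_atTop M).and
        (hsmall.eventually_lt_const (u := η / 2) (by positivity)))).exists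
    have hηk : 1 / ((φ k' : ℝ) + 1) < η / 2 := hηk
    obtain ⟨g, δ, hδ, hgs, hgD⟩ := hE' (φ k') (E (φ k')) s fun x => (hM x).trans hMk
    obtain ⟨c, hc, ⟨M', hM'⟩, hcg⟩ := exists_interpolation (E (φ k' + 1)) g
    have hcs : ∀ x ∈ (E (φ k') : Set X), |c x - s x| ≤ 1 / ((φ k' : ℝ) + 1) := fun x hx => by
      rw [hcg x (hmono (Nat.le_succ _) hx)]
      exact hgs x hx
    obtain ⟨h, hh, hu, hhE, hhU⟩ := exists_glue hs hc (by positivity) hcs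
      (E (φ k' + 1)).finite_toSet.sdiff (hU k').1 (hU k').2
    refine ⟨⟨(k', h, min (η / 2) δ), hh, ⟨max M M', fun x => ?_⟩, by positivity⟩, hk',
      min_le_left _ _, fun x hx => ?_, fun f hf => ?_⟩
    · have h1 := abs_le.1 ((hM x).trans (le_max_left M M'))
      have h2 := abs_le.1 ((hM' x).trans (le_max_right M M'))
      exact abs_le.2 (uIcc_subset_Icc h1 h2 (hu x))
    · rcases hx with hx | hx
      · change |h x - s x| ≤ η / 2
        rw [hhE x (Or.inl hx)]
        exact (hcs x hx).trans hηk.le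
      · exact (hhU x hx).trans hηk.le
    · refine hgD f fun x hx => ?_
      rw [← hE] at hx
      have h1 : h x = g x := by
        rw [← hcg x hx]
        refine hhE x ?_
        by_cases hxE : x ∈ E (φ k')
        · exact Or.inl hxE
        · exact Or.inr ⟨hx, hxE⟩
      rw [← h1]
      exact (hf x hx).trans (min_le_right _ _)
  choose nxt hk hη hclose hmem using step
  let P : ℕ → St := fun n => Nat.rec ⟨(0, s₀, η₀), hs₀, hb₀, hη₀⟩ (fun _ => nxt) n
  set k : ℕ → ℕ := fun j => (P j).1.1 with hkdef
  set s : ℕ → X → ℝ := fun j => (P j).1.2.1 with hsdef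
  set η : ℕ → ℝ := fun j => (P j).1.2.2 with hηdef
  have hkm : StrictMono k := strictMono_nat_of_lt_succ fun j => hk (P j)
  have hη' : ∀ j, 0 ≤ η j ∧ η (j + 1) ≤ η j / 2 := fun j => ⟨(P j).2.2.2.le, hη (P j)⟩
  have hcl : ∀ j x, (x ∈ E (φ (k (j + 1))) ∨ x ∉ U (k (j + 1))) →
      |s (j + 1) x - s j x| ≤ η j / 2 := fun j => hclose (P j)
  have hlim : ∀ x, ∃ b, Tendsto (fun j => s j x) atTop (𝓝 b) := by
    intro x
    refine exists_tendsto_of_geometric hη' ?_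
    have h1 : ∀ᶠ l in atTop, x ∉ U l := by
      rw [← Nat.cofinite_eq_atTop]
      exact (hpf x).eventually_cofinite_notMem
    have h2 := (hkm.tendsto_atTop.comp (tendsto_add_atTop_nat 1)).eventually h1
    filter_upwards [h2] with j hj
    exact hcl j x (Or.inr hj)
  choose f hf using hlim
  -- Points of the `E`-sets in use after stage `J` move by at most `η J` in total, so the limit
  -- keeps the membership in `D` secured at that stage.
  have hfs : ∀ (J : ℕ) (x : X), (∀ j ≥ J, x ∈ E (φ (k (j + 1)))) → |f x - s J x| ≤ η J := by
    intro J x hx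
    have h1 : ∀ᶠ l in atTop, |s l x - s J x| ≤ η J := by
      filter_upwards [eventually_ge_atTop J] with l hl
      exact abs_sub_le_of_geometric (a := fun j => s j x) hη'
        (fun j hj => hcl j x (Or.inl (hx j hj))) l hl
    exact le_of_tendsto ((hf x).sub_const (s J x)).abs h1
  refine ⟨⟨f, s, fun j => (P j).2.1, hf⟩, fun x hx => ?_, fun n => ?_⟩
  · exact hfs 0 x fun j _ => hmono (Nat.zero_le _) (hE0 ▸ hx)
  · refine hD (a := n) (b := φ (k (n + 1))) ?_ (hmem (P n) _ fun x hx => ?_)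
    · exact (Nat.le_succ n).trans ((hkm.id_le (n + 1)).trans (hφ.id_le _))
    · refine hfs (n + 1) x fun j hj => hmono ?_ hx
      exact Nat.succ_le_of_lt (hφ (hkm (Nat.lt_succ_of_le hj)))

theorem HasPropertyKappa.baireSpace_baireOne [T35Space X] (hX : HasPropertyKappa X) :
    BaireSpace (BaireOne X) := by
  have hi : IsInducing (Subtype.val : BaireOne X → X → ℝ) := IsInducing.subtypeVal
  refine ⟨fun D ho hd z => ?_⟩
  rw [hi.mem_closure_iff_finset]
  intro E ε hε
  obtain ⟨s, hs, hb, hsz⟩ := exists_interpolation E z.1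
  obtain ⟨f, hf, hfD⟩ := hX.exists_isBaireOne_mem
    (D := fun n => ⋂ m ∈ Finset.range (n + 1), D m)
    (fun n => isOpen_biInter_finset fun m _ => ho m) (dense_biInter_range_succ ho hd)
    (fun a b hab => biInter_subset_biInter_left fun m hm =>
      Finset.range_mono (Nat.succ_le_succ hab) hm) hs hb E (half_pos hε)
  refine ⟨f, mem_iInter.2 fun n => mem_iInter₂.1 (hfD n) n (Finset.self_mem_range_succ n),
    fun x hx => ?_⟩
  rw [← hsz x hx]
  exact (hf x hx).trans_lt (half_lt_self hε)

end Baire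

/-! ### The equivalences -/

theorem corollary1 {X : Type*} [TopologicalSpace X] [T35Space X] :
    List.TFAE [
      HasPropertyKappa X,
      IsKappaFrechetUrysohn (Cp X ℝ),
      IsKappaFrechetUrysohn (Cp X (Set.Icc (0 : ℝ) 1)),
      IsAscoliSpace (Cp X ℝ),
      ¬ HasBanakhProperty (Cp X ℝ),
      ∀ F : ℕ → Set X, (∀ n, (F n).Finite ∧ (F n).Nonempty) →
        (Pairwise fun m n => Disjoint (F m) (F n)) →
          ∃ φ : ℕ → ℕ, StrictMono φ ∧ IsStronglyCozDeltaDisjointSeq fun k => F (φ k),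
      BaireSpace (BaireOne X)] := by
  have hi : IsInducing (Subtype.val : Cp X ℝ → X → ℝ) := IsInducing.subtypeVal
  have hi' : IsInducing fun (f : Cp X (Icc (0 : ℝ) 1)) (x : X) => (f.1 x : ℝ) :=
    (IsInducing.piMap fun _ : X => IsInducing.subtypeVal (t := Icc (0 : ℝ) 1)).comp
      IsInducing.subtypeVal
  have hc' : ∀ f : Cp X (Icc (0 : ℝ) 1), Continuous fun x => (f.1 x : ℝ) := fun f =>
    continuous_subtype_val.comp f.2
  have hsurj : ∀ h : X → ℝ, Continuous h → (∀ x, 0 ≤ h x ∧ h x ≤ 1) →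
      ∃ f : Cp X (Icc (0 : ℝ) 1), (fun x => (f.1 x : ℝ)) = h := fun h hh hb =>
    ⟨⟨fun x => ⟨h x, hb x⟩, hh.subtype_mk _⟩, rfl⟩
  tfae_have 1 → 2 := fun h =>
    h.isKappaFrechetUrysohn hi (fun f => f.2) fun _ _ h hh _ => ⟨⟨h, hh⟩, rfl⟩
  tfae_have 1 → 3 := fun h =>
    h.isKappaFrechetUrysohn hi' hc' fun f g h hh hu =>
      hsurj h hh fun x => uIcc_subset_Icc (f.1 x).2 (g.1 x).2 (hu x)
  tfae_have 3 → 1 := fun h => h.hasPropertyKappa hi' hc' hsurj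
  tfae_have 2 → 4 := fun h => h.isAscoliSpace
  tfae_have 4 → 1 := fun h => h.hasPropertyKappa
  tfae_have 1 → 5 := fun h => h.not_hasBanakhProperty
  tfae_have 5 → 1 := fun h => hasPropertyKappa_of_not_hasBanakhProperty h
  tfae_have 1 → 6 := fun h F hF hd =>
    h.exists_subseq_isStronglyCozDeltaDisjointSeq (fun n => (hF n).1) hd
  tfae_have 6 → 1 := fun h => hasPropertyKappa_of_nonempty fun F hF hd =>
    let ⟨φ, hφ, h'⟩ := h F hF hd
    ⟨φ, hφ, h'.isStronglyPointFinite⟩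
  tfae_have 1 → 7 := fun h => h.baireSpace_baireOne
  tfae_have 7 → 1 := fun _ => hasPropertyKappa_of_baireSpace
  tfae_finish
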